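/- Let $V$ be a complex vector space of finite dimension $n\ge 0$ and let $u:V\to V$ be a nilpotent endomorphism. Let $Y(u)$ be the Young diagram whose row lengths are the sizes of the Jordan blocks of $u$. Let $\mathcal F_u$ be the Springer fiber, i.e. the set of complete flags $(V_0\subset V_1\subset\dots\subset V_n=V)$, $\dim V_k=k$, with $u(V_k)\subset V_k$ for all $k$, with the topology induced by the Zariski topology of the variety of complete flags of $V$. A standard tableau of shape $Y(u)$ is a numbering of the boxes of $Y(u)$ by $1,\dots,n$ that increases along each row to the right and along each column to the bottom. For such a $T$, let $Y_k(T)$ be the shape of the subtableau $T[1,\dots,k]$ formed by the entries $1,\dots,k$, and let $c_{\le q}T[1,\dots,k]$ be the number of boxes in its first $q$ columns. The dominance order is defined by: $S\preceq T$ if $c_{\le q}S[1,\dots,k]\ge c_{\le q}T[1,\dots,k]$ for all $k$ and all $q$. Fix a double sequence of integers $\rho=(i_k,j_k)_{k=0,\dots,n}$ with $(i_k)_k$ weakly decreasing, $(j_k)_k$ weakly increasing, $0\le i_k\le j_k\le n$ and $j_k-i_k=k$ for every $k$. For a standard tableau $T$ of shape $Y(u)$ let $\mathcal F^\rho_{u,T}$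 be the set of flags $(V_0,\dots,V_n)\in\mathcal F_u$ such that, for every $k=0,\dots,n$, the nilpotent endomorphism induced by $u$ on $V_{j_k}/V_{i_k}$ has Young diagram $Y_k(T)$. Then: (1) for every standard tableau $T$ of shape $Y(u)$, $$\overline{\mathcal F^\rho_{u,T}}\subset\bigcup_{S\preceq T}\mathcal F^\rho_{u,S},$$ where the union is over the standard tableaux $S$ of shape $Y(u)$ with $S\preceq T$, and the closure is taken in $\mathcal F_u$; (2) the sets $\mathcal F^\rho_{u,T}$, for $T$ running over the standard tableaux of shape $Y(u)$, form an $\alpha$-partition of $\mathcal F_u$: they are nonempty, pairwise disjoint, their union is $\mathcal F_u$, they are finite in number, and they can be arranged in a sequence $X_1,\dots,X_m$ such that $X_1\cup\dots\cup X_l$ is closed in $\mathcal F_u$ for every $l=1,\dots,m$. -/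

import Mathlib

noncomputable section

namespace SpringerFiber

open Module

/-! ### Standard tableaux -/

/-- A standard tableau of shape `μ`: a numbering of the boxes by `1, …, |μ|` which increases along
each row to the right and along each column to the bottom. The box `(r, c)` is the one in row `r`
and column `c`, counted from `0`. -/
structure StandardTableau (μ : YoungDiagram) where
  entry : μ.cells ≃ Finset.Icc 1 μ.card
  row_lt : ∀ a b : μ.cells, a.1.1 = b.1.1 → a.1.2 < b.1.2 → (entry a : ℕ) < entry b
  col_lt : ∀ a b : μ.cells, a.1.2 = b.1.2 → a.1.1 < b.1.1 → (entry a : ℕ) < entry b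

namespace StandardTableau

variable {μ : YoungDiagram}

/-- Entries increase weakly from a box to any box which is weakly below and to the right. -/
theorem entry_le (T : StandardTableau μ) {a b : μ.cells} (h : a.1 ≤ b.1) :
    (T.entry a : ℕ) ≤ T.entry b := by
  obtain ⟨⟨a1, a2⟩, ha⟩ := a
  obtain ⟨⟨b1, b2⟩, hb⟩ := b
  have h1 : a1 ≤ b1 := h.1
  have h2 : a2 ≤ b2 := h.2
  have hc : (a1, b2) ∈ μ.cells := μ.isLowerSet (show (a1, b2) ≤ (b1, b2) from ⟨h1, le_rfl⟩) hb
  have e1 : (T.entry ⟨(a1, a2), ha⟩ : ℕ) ≤ T.entry ⟨(a1, b2), hc⟩ := by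
    rcases h2.eq_or_lt with h2 | h2
    · subst h2; exact le_rfl
    · exact (T.row_lt ⟨(a1, a2), ha⟩ ⟨(a1, b2), hc⟩ rfl h2).le
  have e2 : (T.entry ⟨(a1, b2), hc⟩ : ℕ) ≤ T.entry ⟨(b1, b2), hb⟩ := by
    rcases h1.eq_or_lt with h1 | h1
    · subst h1; exact le_rfl
    · exact (T.col_lt ⟨(a1, b2), hc⟩ ⟨(b1, b2), hb⟩ rfl h1).le
  exact e1.trans e2

/-- `Y_k(T)`: the shape of the subtableau `T[1, …, k]` of the entries `1, …, k`. -/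
def shape (T : StandardTableau μ) (k : ℕ) : YoungDiagram where
  cells := (Finset.univ.filter fun a : μ.cells => (T.entry a : ℕ) ≤ k).map
    (Function.Embedding.subtype _)
  isLowerSet := by
    intro b a hab hb
    simp only [Finset.coe_map, Set.mem_image, Finset.mem_coe, Finset.mem_filter,
      Finset.mem_univ, true_and, Function.Embedding.subtype_apply] at hb ⊢
    obtain ⟨b', hb', rfl⟩ := hb
    exact ⟨⟨a, μ.isLowerSet hab b'.2⟩, le_trans (T.entry_le hab) hb', rfl⟩

/-- `c_{≤ q} T[1, …, k]`: the number of boxes in the first `q` columns of `T[1, …, k]`. -/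
def colCount (T : StandardTableau μ) (q k : ℕ) : ℕ :=
  ((T.shape k).cells.filter fun c => c.2 < q).card

/-- The dominance order `S ⪯ T` on the standard tableaux of shape `μ`. -/
def Dominance (S T : StandardTableau μ) : Prop :=
  ∀ k q : ℕ, T.colCount q k ≤ S.colCount q k

end StandardTableau

/-! ### The Young diagram of a nilpotent endomorphism -/

section Jordan

variable {W : Type*} [AddCommGroup W] [Module ℂ W]

/-- The rows of `μ` are the Jordan blocks of the nilpotent endomorphism `u`: there is a basis
indexed by the boxes of `μ` on which `u` moves every box by one step to the left and kills the
boxes of the first column. -/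
def IsJordanDiagram (u : Module.End ℂ W) (μ : YoungDiagram) : Prop :=
  ∃ b : Basis μ.cells ℂ W,
    (∀ a : μ.cells, a.1.2 = 0 → u (b a) = 0) ∧
    ∀ a a' : μ.cells, a.1.1 = a'.1.1 → a.1.2 = a'.1.2 + 1 → u (b a) = b a'

open Classical in
/-- `Y(u)`: the Young diagram whose row lengths are the sizes of the Jordan blocks of the nilpotent
endomorphism `u` (the empty diagram if `u` is not a nilpotent endomorphism of a finite-dimensional
space). -/
def jordanDiagram (u : Module.End ℂ W) : YoungDiagram :=
  if h : ∃ μ, IsJordanDiagram u μ then h.choose else ⊥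

/-- The endomorphism induced by `u` on the subquotient `B / A`, for `u`-stable `A` and `B`
(used for `A ≤ B`; in general this is `B / (A ∩ B)`). -/
def subquotientMap (u : Module.End ℂ W) (A B : Submodule ℂ W)
    (hA : ∀ x ∈ A, u x ∈ A) (hB : ∀ x ∈ B, u x ∈ B) :
    Module.End ℂ (↥B ⧸ A.submoduleOf B) :=
  Submodule.mapQ (A.submoduleOf B) (A.submoduleOf B) (u.restrict hB) fun x hx => hA x.1 hx

end Jordan

/-! ### The flag variety and its Zariski topology -/

/-- The algebra of polynomial functions on a complex vector space: the algebra of functions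
generated by the linear forms. -/
def polynomialFunctions (W : Type*) [AddCommGroup W] [Module ℂ W] : Subalgebra ℂ (W → ℂ) :=
  Algebra.adjoin ℂ (Set.range fun f : Dual ℂ W => (f : W → ℂ))

/-- The Zariski topology of a complex vector space: its closed sets are the common zero sets of
families of polynomial functions. -/
abbrev zariskiTopology (W : Type*) [AddCommGroup W] [Module ℂ W] : TopologicalSpace W :=
  TopologicalSpace.generateFrom {U | ∃ p ∈ polynomialFunctions W, U = {x | p x ≠ 0}}

/-- A complete flag `(V_0, …, V_n)` of `V`, with `n = dim V` and `dim V_k = k`. -/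
structure CompleteFlag (V : Type*) [AddCommGroup V] [Module ℂ V] where
  space : Fin (finrank ℂ V + 1) → Submodule ℂ V
  mono : Monotone space
  finrank_space : ∀ k, finrank ℂ (space k) = k

section Flags

variable {V : Type*} [AddCommGroup V] [Module ℂ V]

/-- The complete flag `V_k = ⟨b_1, …, b_k⟩` spanned by a basis. -/
def CompleteFlag.ofBasis (b : Basis (Fin (finrank ℂ V)) ℂ V) : CompleteFlag V where
  space := b.flag
  mono := b.flag_mono
  finrank_space k := by
    have h : b.flag k = Submodule.span ℂ
        (Set.range fun i : {i : Fin (finrank ℂ V) // i.castSucc < k} => b i) := by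
      rw [Basis.flag]
      congr 1
      ext x
      simp [Set.mem_image]
    have hk : Fintype.card {i : Fin (finrank ℂ V) // i.castSucc < k} = k := by
      rw [Fintype.card_subtype]
      have := Fin.card_filter_val_lt (n := finrank ℂ V) (m := (k : ℕ))
      simp only [Fin.lt_def, Fin.val_castSucc]
      rw [this]
      have := k.2
      omega
    rw [h, ← hk]
    exact finrank_span_eq_card (b.linearIndependent.comp _ Subtype.val_injective)

/-- The Zariski topology on the variety of bases of `V` (a torsor under `GL(V)`), as a subvariety of
the vector space `V ^ n`. -/
abbrev basisTopology (V : Type*) [AddCommGroup V] [Module ℂ V] :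
    TopologicalSpace (Basis (Fin (finrank ℂ V)) ℂ V) :=
  TopologicalSpace.induced (fun b i => b i) (zariskiTopology (Fin (finrank ℂ V) → V))

/-- The Zariski topology of the flag variety `GL(V) / B`: the quotient topology for the map that
sends a basis to the complete flag it spans. -/
instance : TopologicalSpace (CompleteFlag V) :=
  TopologicalSpace.coinduced CompleteFlag.ofBasis (basisTopology V)

/-- The Springer fiber `ℱ_u`: the `u`-stable complete flags, with the topology induced by the
Zariski topology of the flag variety. -/
abbrev Fiber (u : Module.End ℂ V) : Type _ :=
  {F : CompleteFlag V // ∀ k, ∀ x ∈ F.space k, u x ∈ F.space k}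

/-- The double sequences `(i_k, j_k)`, `k = 0, …, n`, with `(i_k)` weakly decreasing, `(j_k)`
weakly increasing, `0 ≤ i_k ≤ j_k ≤ n` and `j_k - i_k = k`. -/
structure DoubleSequence (n : ℕ) where
  i : Fin (n + 1) → Fin (n + 1)
  j : Fin (n + 1) → Fin (n + 1)
  anti : Antitone i
  mono : Monotone j
  add_eq : ∀ k, (i k : ℕ) + k = j k

/-- `ℱ_{u,T}^ρ`: the `u`-stable flags such that, for every `k`, the Young diagram of the
endomorphism induced by `u` on `V_{j_k} / V_{i_k}` is `Y_k(T)`. -/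
def piece (u : Module.End ℂ V) (ρ : DoubleSequence (finrank ℂ V)) {μ : YoungDiagram}
    (T : StandardTableau μ) : Set (Fiber u) :=
  {F | ∀ k, jordanDiagram (subquotientMap u (F.1.space (ρ.i k)) (F.1.space (ρ.j k))
    (F.2 (ρ.i k)) (F.2 (ρ.j k))) = T.shape k}

end Flags

/-- The (nonempty) sets `A i` form a finite partition of `X` whose members can be arranged in a
sequence `X_1, …, X_k` such that `X_1 ∪ … ∪ X_l` is closed for all `l = 1, …, k`. -/
structure IsAlphaPartition {X ι : Type*} [TopologicalSpace X] (A : ι → Set X) : Prop where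
  nonempty : ∀ i, (A i).Nonempty
  disjoint : ∀ i j, i ≠ j → Disjoint (A i) (A j)
  iUnion_eq : ⋃ i, A i = Set.univ
  exists_order : ∃ (k : ℕ) (e : Fin k ≃ ι), ∀ l : Fin k, IsClosed (⋃ m : Fin k, ⋃ _ : m ≤ l, A (e m))

end SpringerFiber

end

noncomputable section

namespace SpringerFiber

open Module

/-! ### Column sums of Young diagrams -/

/-! The proof rests on a numerical dictionary. The first `q` columns of the diagram of a nilpotent
endomorphism contain as many boxes as the dimension of the kernel of its `q`-th power, and these
column sums determine the diagram. For the endomorphism induced by `u` on `B / A` the count is dim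
(B ∩ (u^q)⁻¹A) - dim A, or equivalently dim B - dim (u^q B + A) (`HasDiagram`,
`hasDiagram_iff_sup`). Each piece of the fiber is thus cut out by dimension conditions on the flag.

Covering: column lengths of `B / A` grow when `B` grows or `A` shrinks (`HasDiagram.le_of_le_right`,
`HasDiagram.le_of_le_left`). The diagrams of V_{j_k} / V_{i_k} therefore increase, with `k` boxes at
step `k`, and such a chain is a standard tableau. A tableau is recovered from its shapes, so the
pieces are disjoint.

Nonemptiness: start from `V` and run the chain backwards. At each step either `i` or `j` moves by
one, and the prescribed box is removed by enlarging `A` (`HasDiagram.exists_left`) or by shrinking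
`B` (`HasDiagram.exists_right`).

Closure: dim (u^q V_j + V_i) ≤ r is a closed condition, given by vanishing of minors. This dimension
is j_k minus a column sum, so column sums can only increase in a limit, which is the dominance
relation. Listing the tableaux by decreasing total of their column sums then gives the α-partition.
-/

/-- The number of boxes in the first `q` columns of `μ`. -/
def colSum (μ : YoungDiagram) (q : ℕ) : ℕ :=
  (μ.cells.filter fun c => c.2 < q).card

theorem colSum_succ (μ : YoungDiagram) (q : ℕ) :
    colSum μ (q + 1) = colSum μ q + μ.colLen q := by
  rw [colSum, colSum, YoungDiagram.colLen_eq_card, ← Finset.card_union_of_disjoint]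
  · congr 1
    ext c
    simp only [Finset.mem_filter, Finset.mem_union, YoungDiagram.mem_col_iff,
      YoungDiagram.mem_cells, Nat.lt_succ_iff_lt_or_eq]
    tauto
  · rw [Finset.disjoint_left]
    intro c hc hc'
    simp only [Finset.mem_filter, YoungDiagram.mem_col_iff] at hc hc'
    omega

theorem le_of_colLen_le {μ ν : YoungDiagram} (h : ∀ q, μ.colLen q ≤ ν.colLen q) : μ ≤ ν := by
  rintro ⟨r, c⟩ hc
  exact YoungDiagram.mem_iff_lt_colLen.2 ((YoungDiagram.mem_iff_lt_colLen.1 hc).trans_le (h c))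

theorem eq_of_colSum_eq {μ ν : YoungDiagram} (h : ∀ q, colSum μ q = colSum ν q) : μ = ν := by
  have h' : ∀ q, μ.colLen q = ν.colLen q := fun q => by
    have := h (q + 1)
    rw [colSum_succ, colSum_succ, h q] at this
    omega
  exact le_antisymm (le_of_colLen_le fun q => (h' q).le) (le_of_colLen_le fun q => (h' q).ge)

/-- Removing one box, in column `c`, from a Young diagram. -/
theorem exists_column_of_card_succ {μ ν : YoungDiagram} (h : ν ≤ μ)
    (hc : μ.card = ν.card + 1) :
    ∃ c, (∀ q, colSum μ q = colSum ν q + if c < q then 1 else 0) ∧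
      μ.colLen (c + 1) < μ.colLen c := by
  have hs : ν.cells ⊆ μ.cells := YoungDiagram.cells_subset_iff.2 h
  have h1 : (μ.cells \ ν.cells).card = 1 := by
    rw [Finset.card_sdiff_of_subset hs]
    change μ.cells.card = ν.cells.card + 1 at hc
    omega
  obtain ⟨⟨r, c⟩, hrc⟩ := Finset.card_eq_one.1 h1
  have hnot : (r, c) ∉ ν.cells := by
    have : (r, c) ∈ μ.cells \ ν.cells := by rw [hrc]; simp
    exact (Finset.mem_sdiff.1 this).2
  have hμ : μ.cells = insert (r, c) ν.cells := by
    rw [← Finset.sdiff_union_of_subset hs, hrc]; rfl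
  have key : ∀ q, colSum μ q = colSum ν q + if c < q then 1 else 0 := by
    intro q
    rw [colSum, colSum, hμ, Finset.filter_insert]
    split_ifs with hq
    · rw [Finset.card_insert_of_notMem]
      simp [hnot]
    · rfl
  refine ⟨c, key, ?_⟩
  -- Taking differences at `c`, `c + 1` and `c + 2` shows that column `c` gained one box and column
  -- `c + 1` none, so `c` ends in a corner of `μ`.
  have e0 := key c
  have e1 := key (c + 1)
  have e2 := key (c + 2)
  rw [if_neg (lt_irrefl c)] at e0
  rw [if_pos (Nat.lt_succ_self c), colSum_succ, colSum_succ] at e1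
  rw [if_pos (by omega), colSum_succ, colSum_succ, colSum_succ, colSum_succ] at e2
  have := ν.colLen_anti c (c + 1) (Nat.le_succ c)
  omega

/-! ### Standard tableaux and chains of diagrams -/

namespace StandardTableau

variable {μ : YoungDiagram}

theorem mem_shape (T : StandardTableau μ) {k : ℕ} {c : ℕ × ℕ} :
    c ∈ T.shape k ↔ ∃ h : c ∈ μ.cells, (T.entry ⟨c, h⟩ : ℕ) ≤ k := by
  change c ∈ (T.shape k).cells ↔ _
  simp [shape]

theorem one_le_entry (T : StandardTableau μ) (a : μ.cells) : 1 ≤ (T.entry a : ℕ) :=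
  (Finset.mem_Icc.1 (T.entry a).2).1

theorem entry_le_card (T : StandardTableau μ) (a : μ.cells) : (T.entry a : ℕ) ≤ μ.card :=
  (Finset.mem_Icc.1 (T.entry a).2).2

theorem shape_mono (T : StandardTableau μ) {k l : ℕ} (h : k ≤ l) : T.shape k ≤ T.shape l := by
  intro c hc
  obtain ⟨hμ, hk⟩ := T.mem_shape.1 hc
  exact T.mem_shape.2 ⟨hμ, hk.trans h⟩

theorem shape_of_card_le (T : StandardTableau μ) {k : ℕ} (h : μ.card ≤ k) : T.shape k = μ := by
  apply le_antisymm
  · intro c hc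
    exact (T.mem_shape.1 hc).1
  · intro c hc
    exact T.mem_shape.2 ⟨hc, (T.entry_le_card _).trans h⟩

theorem card_shape (T : StandardTableau μ) {k : ℕ} (h : k ≤ μ.card) : (T.shape k).card = k := by
  change (T.shape k).cells.card = k
  rw [shape, Finset.card_map]
  calc _ = (Finset.Icc 1 k).card := by
        apply Finset.card_bij fun a _ => (T.entry a : ℕ)
        · intro a ha
          exact Finset.mem_Icc.2 ⟨T.one_le_entry a, (Finset.mem_filter.1 ha).2⟩
        · intro a _ b _ hab
          exact T.entry.injective (Subtype.ext hab)
        · intro m hm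
          rw [Finset.mem_Icc] at hm
          refine ⟨T.entry.symm ⟨m, Finset.mem_Icc.2 ⟨hm.1, hm.2.trans h⟩⟩, ?_, ?_⟩ <;>
            simp [hm.2]
    _ = k := by simp

theorem eq_of_shape_eq {S T : StandardTableau μ}
    (h : ∀ k ≤ μ.card, S.shape k = T.shape k) : S = T := by
  have key : ∀ S T : StandardTableau μ, (∀ k ≤ μ.card, S.shape k = T.shape k) →
      ∀ a, (S.entry a : ℕ) ≤ T.entry a := by
    intro S T h a
    have : a.1 ∈ T.shape (T.entry a) := T.mem_shape.2 ⟨a.2, le_rfl⟩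
    rw [← h _ (T.entry_le_card a)] at this
    exact (S.mem_shape.1 this).2
  have he : S.entry = T.entry := by
    ext a
    exact le_antisymm (key S T h a) (key T S (fun k hk => (h k hk).symm) a)
  cases S
  cases T
  cases he
  rfl

/-- A chain of Young diagrams growing by one box at each step is a standard tableau. -/
theorem exists_of_chain (Y : ℕ → YoungDiagram) (hmono : Monotone Y)
    (hcard : ∀ k ≤ μ.card, (Y k).card = k) (hY : Y μ.card = μ) :
    ∃ T : StandardTableau μ, ∀ k ≤ μ.card, T.shape k = Y k := by
  classical
  have hex : ∀ a : μ.cells, ∃ k, a.1 ∈ Y k := fun a => ⟨μ.card, by rw [hY]; exact a.2⟩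
  have hY0 : Y 0 = ⊥ := by
    have := hcard 0 (Nat.zero_le _)
    apply YoungDiagram.ext
    rw [YoungDiagram.cells_bot]
    exact Finset.card_eq_zero.1 this
  -- The entry of a box is the first step of the chain at which it appears; only one box appears at
  -- each step, whence injectivity.
  let e : μ.cells → ℕ := fun a => Nat.find (hex a)
  have he_iff : ∀ a k, e a ≤ k ↔ a.1 ∈ Y k := fun a k =>
    ⟨fun h => hmono h (Nat.find_spec (hex a)), fun h => Nat.find_le h⟩
  have he_mem : ∀ a, e a ∈ Finset.Icc 1 μ.card := by
    intro a
    rw [Finset.mem_Icc]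
    constructor
    · by_contra h
      have h0 := (he_iff a 0).1 (by omega)
      rw [hY0] at h0
      exact YoungDiagram.notMem_bot _ h0
    · rw [he_iff, hY]
      exact a.2
  have he_inj : ∀ a b, e a = e b → a = b := by
    intro a b hab
    obtain ⟨h1, h2⟩ := Finset.mem_Icc.1 (he_mem a)
    obtain ⟨k, hk⟩ : ∃ k, e a = k + 1 := ⟨e a - 1, by omega⟩
    have hsub : (Y k).cells ⊆ (Y (k + 1)).cells :=
      YoungDiagram.cells_subset_iff.2 (hmono (Nat.le_succ k))
    have h3 : ((Y (k + 1)).cells \ (Y k).cells).card ≤ 1 := by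
      have c1 : (Y k).cells.card = k := hcard k (by omega)
      have c2 : (Y (k + 1)).cells.card = k + 1 := hcard (k + 1) (by omega)
      rw [Finset.card_sdiff_of_subset hsub]
      omega
    have hm : ∀ a, e a = k + 1 → a.1 ∈ (Y (k + 1)).cells \ (Y k).cells := by
      intro a ha
      rw [Finset.mem_sdiff]
      refine ⟨(he_iff a _).1 ha.le, fun h => ?_⟩
      have := (he_iff a k).2 h
      omega
    exact Subtype.ext (Finset.card_le_one.1 h3 _ (hm a hk) _ (hm b (hab ▸ hk)))
  let f : μ.cells → Finset.Icc 1 μ.card := fun a => ⟨e a, he_mem a⟩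
  have hf : Function.Bijective f := by
    rw [Fintype.bijective_iff_injective_and_card]
    refine ⟨fun a b hab => he_inj a b (congrArg Subtype.val hab), ?_⟩
    simp [YoungDiagram.card]
  have hle : ∀ a b : μ.cells, a.1 ≤ b.1 → a ≠ b → e a < e b := by
    intro a b hab hne
    refine lt_of_le_of_ne ?_ fun h => hne (he_inj a b h)
    rw [he_iff]
    exact (Y (e b)).isLowerSet hab ((he_iff b _).1 le_rfl)
  refine ⟨⟨Equiv.ofBijective f hf, ?_, ?_⟩, ?_⟩
  · intro a b h1 h2
    exact hle a b ⟨h1.le, h2.le⟩ fun h => by subst h; exact lt_irrefl _ h2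
  · intro a b h1 h2
    exact hle a b ⟨h2.le, h1.le⟩ fun h => by subst h; exact lt_irrefl _ h2
  · intro k hk
    ext c
    rw [YoungDiagram.mem_cells, YoungDiagram.mem_cells, mem_shape]
    constructor
    · rintro ⟨h, hc⟩
      exact (he_iff ⟨c, h⟩ k).1 hc
    · intro hc
      have hμ : c ∈ μ := hY ▸ hmono hk hc
      exact ⟨hμ, (he_iff ⟨c, hμ⟩ k).2 hc⟩

instance : Finite (StandardTableau μ) :=
  Finite.of_injective (fun T : StandardTableau μ => T.entry) fun S T h => by
    cases S
    cases T
    cases h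
    rfl

theorem colCount_eq_colSum (T : StandardTableau μ) (q k : ℕ) :
    T.colCount q k = colSum (T.shape k) q := rfl

theorem dominance_of_colSum_le {S T : StandardTableau μ}
    (h : ∀ k ≤ μ.card, ∀ q, colSum (T.shape k) q ≤ colSum (S.shape k) q) : S.Dominance T := by
  intro k q
  rw [colCount_eq_colSum, colCount_eq_colSum]
  rcases le_total k μ.card with hk | hk
  · exact h k hk q
  · rw [S.shape_of_card_le hk, T.shape_of_card_le hk]

/-- A numerical function which strictly decreases along the dominance order. -/
def weight (T : StandardTableau μ) : ℕ :=
  ∑ k ∈ Finset.range (μ.card + 1), ∑ q ∈ Finset.range (μ.card + 1), T.colCount q k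

/-- A box in column `c` forces the `c + 1` boxes of its row up to it, so every column index is less
than `ν.card`. This makes the truncated sums in `weight` sufficient. -/
theorem colSum_eq_of_card_le {ν : YoungDiagram} {n q : ℕ} (hν : ν.card ≤ n) (hq : n ≤ q) :
    colSum ν q = colSum ν n := by
  have : ∀ m, n ≤ m → colSum ν m = ν.card := by
    intro m hm
    rw [colSum, Finset.filter_true_of_mem]
    rintro ⟨r, c⟩ hc
    have hsub : (Finset.range (c + 1)).map ⟨fun d => (r, d), fun a b h => (Prod.ext_iff.1 h).2⟩ ⊆
        ν.cells := by
      intro x hx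
      simp only [Finset.mem_map, Finset.mem_range] at hx
      obtain ⟨d, hd, rfl⟩ := hx
      exact ν.isLowerSet (show (r, d) ≤ (r, c) from ⟨le_rfl, by omega⟩) hc
    have := Finset.card_le_card hsub
    rw [Finset.card_map, Finset.card_range] at this
    change ν.cells.card ≤ n at hν
    change c < m
    omega
  rw [this q hq, this n le_rfl]

/-- Dominance compares the two weights term by term, so the reverse inequality of the sums forces
equality of all column counts. -/
theorem eq_of_dominance_of_weight_le {S T : StandardTableau μ} (h : S.Dominance T)
    (hw : S.weight ≤ T.weight) : S = T := by
  have h1 : ∀ k ∈ Finset.range (μ.card + 1), ∀ q ∈ Finset.range (μ.card + 1),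
      T.colCount q k = S.colCount q k := by
    have hle : ∀ k ∈ Finset.range (μ.card + 1),
        ∑ q ∈ Finset.range (μ.card + 1), T.colCount q k ≤
          ∑ q ∈ Finset.range (μ.card + 1), S.colCount q k :=
      fun k _ => Finset.sum_le_sum fun q _ => h k q
    have heq := (Finset.sum_eq_sum_iff_of_le hle).1 (le_antisymm (Finset.sum_le_sum hle) hw)
    exact fun k hk => (Finset.sum_eq_sum_iff_of_le fun q _ => h k q).1 (heq k hk)
  refine eq_of_shape_eq fun k hk => eq_of_colSum_eq fun q => ?_
  rcases le_total q μ.card with hq | hq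
  · exact (h1 k (by simpa [Nat.lt_succ_iff] using hk) q
      (by simpa [Nat.lt_succ_iff] using hq)).symm
  · have c1 := S.card_shape hk
    have c2 := T.card_shape hk
    rw [colSum_eq_of_card_le (c1.trans_le hk) hq, colSum_eq_of_card_le (c2.trans_le hk) hq]
    exact (h1 k (by simpa [Nat.lt_succ_iff] using hk) μ.card (by simp)).symm

end StandardTableau

/-! ### Jordan bases -/

theorem map_pow_apply {W W' : Type*} [AddCommGroup W] [Module ℂ W] [AddCommGroup W']
    [Module ℂ W'] {u : Module.End ℂ W} {u' : Module.End ℂ W'} (f : W →ₗ[ℂ] W')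
    (h : ∀ x, f (u x) = u' (f x)) (k : ℕ) (x : W) : f ((u ^ k) x) = (u' ^ k) (f x) := by
  induction k generalizing x with
  | zero => rfl
  | succ k ih => rw [pow_succ, pow_succ, Module.End.mul_apply, Module.End.mul_apply, ih, h]

section JordanBasis

variable {W : Type*} [AddCommGroup W] [Module ℂ W]

theorem pow_apply_basis_eq_zero {u : Module.End ℂ W} {μ : YoungDiagram} {b : Basis μ.cells ℂ W}
    (h0 : ∀ a : μ.cells, a.1.2 = 0 → u (b a) = 0)
    (h1 : ∀ a a' : μ.cells, a.1.1 = a'.1.1 → a.1.2 = a'.1.2 + 1 → u (b a) = b a')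
    {q : ℕ} : ∀ a : μ.cells, a.1.2 < q → (u ^ q) (b a) = 0 := by
  induction q with
  | zero => intro a ha; exact absurd ha (Nat.not_lt_zero _)
  | succ q ih =>
    rintro ⟨⟨r, c⟩, ha⟩ hq
    rw [pow_succ, Module.End.mul_apply]
    cases c with
    | zero => rw [h0 _ rfl, map_zero]
    | succ c =>
      have hc : (r, c) ∈ μ.cells :=
        μ.isLowerSet (show (r, c) ≤ (r, c + 1) from ⟨le_rfl, Nat.le_succ c⟩) ha
      rw [h1 ⟨(r, c + 1), ha⟩ ⟨(r, c), hc⟩ rfl rfl]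
      exact ih _ (Nat.lt_of_succ_lt_succ hq)

theorem pow_apply_basis_eq {u : Module.End ℂ W} {μ : YoungDiagram} {b : Basis μ.cells ℂ W}
    (h1 : ∀ a a' : μ.cells, a.1.1 = a'.1.1 → a.1.2 = a'.1.2 + 1 → u (b a) = b a') {q : ℕ} :
    ∀ a a' : μ.cells, a.1.1 = a'.1.1 → a.1.2 = a'.1.2 + q → (u ^ q) (b a) = b a' := by
  induction q with
  | zero =>
    intro a a' h h'
    have : a = a' := Subtype.ext (Prod.ext h h')
    rw [this, pow_zero, Module.End.one_apply]
  | succ q ih =>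
    rintro ⟨⟨r, c⟩, ha⟩ ⟨⟨r', c'⟩, ha'⟩ hr hc
    change r = r' at hr
    change c = c' + (q + 1) at hc
    subst hr
    subst hc
    have hm : (r, c' + q) ∈ μ.cells :=
      μ.isLowerSet (show (r, c' + q) ≤ (r, c' + (q + 1)) from ⟨le_rfl, by omega⟩) ha
    rw [pow_succ, Module.End.mul_apply, h1 ⟨(r, c' + (q + 1)), ha⟩ ⟨(r, c' + q), hm⟩ rfl rfl]
    exact ih _ _ rfl rfl

theorem card_filter_cells (μ : YoungDiagram) (p : ℕ × ℕ → Prop) [DecidablePred p] :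
    Fintype.card {a : μ.cells // p a.1} = (μ.cells.filter p).card := by
  rw [Fintype.card_subtype]
  rw [← Finset.card_map (Function.Embedding.subtype _)]
  congr 1
  ext ⟨i, j⟩
  simp only [Finset.mem_map, Finset.mem_filter, Finset.mem_univ, true_and,
    Function.Embedding.subtype_apply]
  exact ⟨fun ⟨a, ha, h⟩ => h ▸ ⟨a.2, ha⟩, fun ⟨h, hp⟩ => ⟨⟨_, h⟩, hp, rfl⟩⟩

theorem IsJordanDiagram.card_eq {u : Module.End ℂ W} {μ : YoungDiagram}
    (h : IsJordanDiagram u μ) : μ.card = finrank ℂ W := by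
  obtain ⟨b, -, -⟩ := h
  rw [finrank_eq_card_basis b, Fintype.card_coe]

/-- Boxes in the first `q` columns give independent vectors of the kernel; the others, shifted left
by `q`, give independent vectors of the range. By rank-nullity both lower bounds are sharp. -/
theorem IsJordanDiagram.finrank_ker_pow {u : Module.End ℂ W} {μ : YoungDiagram}
    (h : IsJordanDiagram u μ) (q : ℕ) : finrank ℂ (LinearMap.ker (u ^ q)) = colSum μ q := by
  have hcard := h.card_eq
  obtain ⟨b, h0, h1⟩ := h
  have : FiniteDimensional ℂ W := b.finiteDimensional_of_finite
  have e1 : colSum μ q ≤ finrank ℂ (LinearMap.ker (u ^ q)) := by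
    have hli : LinearIndependent ℂ fun a : {a : μ.cells // a.1.2 < q} => b a.1 :=
      b.linearIndependent.comp _ Subtype.val_injective
    rw [colSum, ← card_filter_cells μ fun c => c.2 < q, ← finrank_span_eq_card hli]
    apply Submodule.finrank_mono
    rw [Submodule.span_le]
    rintro _ ⟨a, rfl⟩
    exact pow_apply_basis_eq_zero h0 h1 a.1 a.2
  have e2 : (μ.cells.filter fun c => ¬ c.2 < q).card ≤ finrank ℂ (LinearMap.range (u ^ q)) := by
    have hmem : ∀ a : {a : μ.cells // ¬ a.1.2 < q}, (a.1.1.1, a.1.1.2 - q) ∈ μ.cells := fun a =>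
      μ.isLowerSet (show (a.1.1.1, a.1.1.2 - q) ≤ a.1.1 from ⟨le_rfl, Nat.sub_le _ _⟩) a.1.2
    have hli : LinearIndependent ℂ
        fun a : {a : μ.cells // ¬ a.1.2 < q} => b ⟨(a.1.1.1, a.1.1.2 - q), hmem a⟩ := by
      apply b.linearIndependent.comp
      rintro ⟨⟨⟨r, c⟩, ha⟩, hq⟩ ⟨⟨⟨r', c'⟩, ha'⟩, hq'⟩ h
      simp only [Subtype.mk.injEq, Prod.mk.injEq] at h hq hq' ⊢
      omega
    rw [← card_filter_cells μ fun c => ¬ c.2 < q, ← finrank_span_eq_card hli]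
    apply Submodule.finrank_mono
    rw [Submodule.span_le]
    rintro _ ⟨a, rfl⟩
    refine ⟨b a.1, pow_apply_basis_eq h1 _ _ rfl ?_⟩
    have := a.2
    simp only
    omega
  have e3 := LinearMap.finrank_range_add_finrank_ker (u ^ q)
  have e4 := Finset.card_filter_add_card_filter_not (s := μ.cells) fun c => c.2 < q
  change μ.cells.card = _ at hcard
  rw [colSum] at e1 ⊢
  omega

theorem exists_linearIndependent_sumElim [FiniteDimensional ℂ W] {m : ℕ} {x : Fin m → W}
    (hx : LinearIndependent ℂ x) :
    ∃ (s : ℕ) (c : Fin s → W), LinearIndependent ℂ (Sum.elim x c) ∧ m + s = finrank ℂ W := by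
  obtain ⟨C, hC⟩ := Submodule.exists_isCompl (Submodule.span ℂ (Set.range x))
  let b := finBasis ℂ C
  refine ⟨finrank ℂ C, fun i => b i, hx.sum_type ?_ ?_, ?_⟩
  · exact b.linearIndependent.map' C.subtype (Submodule.ker_subtype C)
  · refine hC.disjoint.mono_right ?_
    rw [Submodule.span_le]
    rintro _ ⟨i, rfl⟩
    exact (b i).2
  · rw [← Submodule.finrank_add_eq_of_isCompl hC, finrank_span_eq_card hx, Fintype.card_fin]

end JordanBasis

/-- The diagram obtained from `ν` by adding a first column of length `d`. -/
def addColumn (ν : YoungDiagram) (d : ℕ) (h : ν.colLen 0 ≤ d) : YoungDiagram where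
  cells := (Finset.range d).image (fun r => (r, 0)) ∪ ν.cells.image fun c => (c.1, c.2 + 1)
  isLowerSet := by
    have hlt : ∀ {r c : ℕ}, (r, c) ∈ ν → r < d := fun {r c} hrc =>
      ((YoungDiagram.mem_iff_lt_colLen.1 hrc).trans_le (ν.colLen_anti 0 c (Nat.zero_le _))).trans_le
        h
    rintro ⟨r, c⟩ ⟨r', c'⟩ ⟨h1, h2⟩ hrc
    simp only [Finset.coe_union, Finset.coe_image, Set.mem_union, Set.mem_image, Finset.mem_coe,
      Finset.mem_range, Prod.mk.injEq, Prod.exists,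
      YoungDiagram.mem_cells] at hrc h1 h2 ⊢
    rcases hrc with ⟨x, hx, rfl, rfl⟩ | ⟨x, y, hxy, rfl, rfl⟩
    · exact Or.inl ⟨r', by omega, rfl, by omega⟩
    · rcases c' with _ | c'
      · exact Or.inl ⟨r', h1.trans_lt (hlt hxy), rfl, rfl⟩
      · exact Or.inr ⟨r', c', ν.up_left_mem h1 (by omega) hxy, rfl, rfl⟩

theorem mem_addColumn {ν : YoungDiagram} {d : ℕ} {h : ν.colLen 0 ≤ d} {r c : ℕ} :
    (r, c) ∈ (addColumn ν d h).cells ↔ (c = 0 ∧ r < d) ∨ ∃ c', c = c' + 1 ∧ (r, c') ∈ ν := by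
  simp only [addColumn, Finset.mem_union, Finset.mem_image, Finset.mem_range, Prod.mk.injEq, Prod.exists, YoungDiagram.mem_cells]
  constructor
  · rintro (⟨x, hx, rfl, rfl⟩ | ⟨x, y, hxy, rfl, rfl⟩)
    · exact Or.inl ⟨rfl, hx⟩
    · exact Or.inr ⟨y, rfl, hxy⟩
  · rintro (⟨rfl, hr⟩ | ⟨y, rfl, hxy⟩)
    · exact Or.inl ⟨r, hr, rfl, rfl⟩
    · exact Or.inr ⟨r, y, hxy, rfl, rfl⟩

/-- Boxes of `addColumn ν d h`: those of the new column, and those of `ν`. -/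
def addColumnEquiv (ν : YoungDiagram) (d : ℕ) (h : ν.colLen 0 ≤ d) :
    Fin d ⊕ ν.cells ≃ (addColumn ν d h).cells :=
  Equiv.ofBijective
    (Sum.elim (fun r => ⟨(r, 0), mem_addColumn.2 (Or.inl ⟨rfl, r.2⟩)⟩)
      fun a => ⟨(a.1.1, a.1.2 + 1), mem_addColumn.2 (Or.inr ⟨_, rfl, a.2⟩)⟩) <| by
    constructor
    · rintro (r | ⟨⟨r, c⟩, ha⟩) (r' | ⟨⟨r', c'⟩, ha'⟩) hab
      · simpa [Fin.ext_iff] using hab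
      · simp at hab
      · simp at hab
      · simpa using hab
    · rintro ⟨⟨r, c⟩, ha⟩
      rcases mem_addColumn.1 ha with ⟨rfl, hr⟩ | ⟨c, rfl, hc⟩
      · exact ⟨Sum.inl ⟨r, hr⟩, rfl⟩
      · exact ⟨Sum.inr ⟨(r, c), hc⟩, rfl⟩

/-- Every nilpotent endomorphism has a Jordan basis. -/
theorem exists_isJordanDiagram_aux (n : ℕ) : ∀ {W : Type*} [AddCommGroup W] [Module ℂ W]
    [FiniteDimensional ℂ W] (u : Module.End ℂ W), finrank ℂ W = n → IsNilpotent u →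
    ∃ μ, IsJordanDiagram u μ := by
  induction n using Nat.strong_induction_on with
  | _ n ih =>
  intro W _ _ _ u hn hu
  rcases Nat.eq_zero_or_pos n with rfl | hpos
  · have : Subsingleton W := finrank_zero_iff.1 hn
    have : IsEmpty (⊥ : YoungDiagram).cells := by
      rw [YoungDiagram.cells_bot]; exact inferInstance
    exact ⟨⊥, Basis.empty W, fun a => isEmptyElim a, fun a => isEmptyElim a⟩
  -- The induction passes to the range of `u`, which is proper because a surjective nilpotent map
  -- lives only on the zero space.
  have hlt : finrank ℂ (LinearMap.range u) < n := by
    rw [← hn]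
    refine Submodule.finrank_lt fun htop => ?_
    have hs : Function.Surjective u := LinearMap.range_eq_top.1 htop
    obtain ⟨k, hk⟩ := hu
    have hsk : Function.Surjective (u ^ k) := by
      rw [Module.End.coe_pow]; exact hs.iterate k
    rw [hk] at hsk
    have : Subsingleton W := ⟨fun x y => by
      obtain ⟨x, rfl⟩ := hsk x
      obtain ⟨y, rfl⟩ := hsk y
      rfl⟩
    have := finrank_zero_of_subsingleton (R := ℂ) (M := W)
    omega
  have hmaps : ∀ x ∈ LinearMap.range u, u x ∈ LinearMap.range u := fun x _ => ⟨x, rfl⟩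
  obtain ⟨ν, b, hb0, hb1⟩ := ih _ hlt (u.restrict hmaps) rfl
    (by
      obtain ⟨k, hk⟩ := hu
      refine ⟨k, LinearMap.ext fun x => Subtype.ext ?_⟩
      have := map_pow_apply (u := u.restrict hmaps) (LinearMap.range u).subtype (fun _ => rfl) k x
      rw [hk] at this
      exact this)
  have hcard : ν.card = finrank ℂ (LinearMap.range u) :=
    IsJordanDiagram.card_eq ⟨b, hb0, hb1⟩
  replace hb0 : ∀ a : ν.cells, a.1.2 = 0 → u (b a) = 0 := fun a ha =>
    congrArg Subtype.val (hb0 a ha)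
  replace hb1 : ∀ a a' : ν.cells, a.1.1 = a'.1.1 → a.1.2 = a'.1.2 + 1 →
      u (b a) = (b a' : W) := fun a a' h h' => congrArg Subtype.val (hb1 a a' h h')
  have hbli : LinearIndependent ℂ fun a => (b a : W) :=
    b.linearIndependent.map' (LinearMap.range u).subtype (Submodule.ker_subtype _)
  have hmem : ∀ r : Fin (ν.colLen 0), ((r : ℕ), 0) ∈ ν.cells := fun r =>
    YoungDiagram.mem_iff_lt_colLen.2 r.2
  -- The first column of the Jordan basis of the range lies in ker u; completed to a basis of ker u,
  -- it becomes the first column of the new diagram.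
  let x : Fin (ν.colLen 0) → LinearMap.ker u := fun r => ⟨b ⟨(r, 0), hmem r⟩, hb0 _ rfl⟩
  have hx : LinearIndependent ℂ x := by
    apply LinearIndependent.of_comp (LinearMap.ker u).subtype
    apply hbli.comp (fun r : Fin (ν.colLen 0) => (⟨(r, 0), hmem r⟩ : ν.cells))
    intro r r' h
    simpa [Fin.ext_iff] using h
  obtain ⟨s, z, hz, hs⟩ := exists_linearIndependent_sumElim hx
  have hd : ν.colLen 0 ≤ ν.colLen 0 + s := Nat.le_add_right _ _
  let κ : Fin (ν.colLen 0 + s) → LinearMap.ker u := Sum.elim x z ∘ finSumFinEquiv.symm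
  have hκ : LinearIndependent ℂ κ := hz.comp _ finSumFinEquiv.symm.injective
  have hκx : ∀ a : ν.cells, ∀ h : a.1.1 < ν.colLen 0 + s, a.1.2 = 0 →
      (κ ⟨a.1.1, h⟩ : W) = b a := by
    rintro ⟨⟨r, c⟩, ha⟩ h hc
    change c = 0 at hc
    subst hc
    have hr : r < ν.colLen 0 := YoungDiagram.mem_iff_lt_colLen.1 ha
    have : (⟨r, h⟩ : Fin (ν.colLen 0 + s)) = finSumFinEquiv (Sum.inl ⟨r, hr⟩) := by
      ext; simp
    simp only [κ, this, Function.comp_apply, Equiv.symm_apply_apply, Sum.elim_inl, x]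
  -- All old boxes move one column to the right: a box is lifted to its right neighbour in the row
  -- when there is one, and to an arbitrary preimage at the end of a row.
  have hy : ∀ a : ν.cells, ∃ y, u y = b a ∧
      ∀ h : (a.1.1, a.1.2 + 1) ∈ ν.cells, y = b ⟨(a.1.1, a.1.2 + 1), h⟩ := by
    intro a
    by_cases h : (a.1.1, a.1.2 + 1) ∈ ν.cells
    · exact ⟨b ⟨_, h⟩, hb1 _ _ rfl rfl, fun _ => rfl⟩
    · obtain ⟨y, hy⟩ := (b a).2
      exact ⟨y, hy, fun h' => absurd h' h⟩
  choose y hy hyb using hy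
  let w : Fin (ν.colLen 0 + s) ⊕ ν.cells → W := Sum.elim (fun r => (κ r : W)) y
  have huy : LinearIndependent ℂ (u ∘ y) := by
    rw [show u ∘ y = fun a => (b a : W) from funext hy]
    exact hbli
  -- `u` sends the lifts to independent vectors, so their span meets ker u trivially.
  have hw : LinearIndependent ℂ w := by
    refine LinearIndependent.sum_type (hκ.map' _ (Submodule.ker_subtype _))
      (LinearIndependent.of_comp u huy) ?_
    · refine (Submodule.range_ker_disjoint (f := u) huy).symm.mono_left ?_
      · rw [Submodule.span_le]
        rintro _ ⟨r, rfl⟩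
        exact (κ r).2
  have hwcard : Fintype.card (Fin (ν.colLen 0 + s) ⊕ ν.cells) = finrank ℂ W := by
    rw [Fintype.card_sum, Fintype.card_fin, Fintype.card_coe,
      ← LinearMap.finrank_range_add_finrank_ker u, hs, ← hcard, add_comm]
  let B : Basis (Fin (ν.colLen 0 + s) ⊕ ν.cells) ℂ W :=
    Basis.mk hw (hw.span_eq_top_of_card_eq_finrank' hwcard).ge
  let e := addColumnEquiv ν (ν.colLen 0 + s) hd
  have hB : ∀ i, B.reindex e (e i) = w i := fun i => by
    rw [Basis.reindex_apply, Equiv.symm_apply_apply, Basis.mk_apply]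
  refine ⟨addColumn ν (ν.colLen 0 + s) hd, B.reindex e, ?_, ?_⟩
  · intro a ha
    obtain ⟨i, rfl⟩ := e.surjective a
    rw [hB]
    rcases i with r | a
    · exact (κ r).2
    · exact absurd ha (Nat.succ_ne_zero _)
  · intro a a' h1 h2
    obtain ⟨i, rfl⟩ := e.surjective a
    obtain ⟨i', rfl⟩ := e.surjective a'
    rw [hB, hB]
    rcases i with r | ⟨⟨r, c⟩, ha⟩
    · exact absurd h2.symm (Nat.succ_ne_zero _)
    · refine (hy _).trans ?_
      rcases i' with ⟨r', hr'⟩ | ⟨⟨r', c'⟩, ha'⟩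
      · change r = r' at h1
        change c + 1 = 0 + 1 at h2
        subst h1
        exact (hκx ⟨(r, c), ha⟩ hr' (by simpa using h2)).symm
      · change r = r' at h1
        change c + 1 = c' + 1 + 1 at h2
        obtain rfl : c = c' + 1 := by omega
        subst h1
        exact (hyb ⟨(r, c'), ha'⟩ ha).symm

section JordanDiagram

variable {W : Type*} [AddCommGroup W] [Module ℂ W] [FiniteDimensional ℂ W]

theorem exists_isJordanDiagram (u : Module.End ℂ W) (hu : IsNilpotent u) :
    ∃ μ, IsJordanDiagram u μ :=
  exists_isJordanDiagram_aux _ u rfl hu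

theorem isJordanDiagram_jordanDiagram {u : Module.End ℂ W} (hu : IsNilpotent u) :
    IsJordanDiagram u (jordanDiagram u) := by
  have h := exists_isJordanDiagram u hu
  rw [jordanDiagram, dif_pos h]
  exact h.choose_spec

theorem colSum_jordanDiagram {u : Module.End ℂ W} (hu : IsNilpotent u) (q : ℕ) :
    colSum (jordanDiagram u) q = finrank ℂ (LinearMap.ker (u ^ q)) :=
  ((isJordanDiagram_jordanDiagram hu).finrank_ker_pow q).symm

theorem card_jordanDiagram {u : Module.End ℂ W} (hu : IsNilpotent u) :
    (jordanDiagram u).card = finrank ℂ W :=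
  (isJordanDiagram_jordanDiagram hu).card_eq

end JordanDiagram

/-! ### Dimensions in the lattice of subspaces -/

section Lattice

variable {V : Type*} [AddCommGroup V] [Module ℂ V] [FiniteDimensional ℂ V]

theorem finrank_map_mkQ_add (P A : Submodule ℂ V) :
    finrank ℂ (P.map A.mkQ) + finrank ℂ A = finrank ℂ (P ⊔ A : Submodule ℂ V) := by
  have h1 := LinearMap.finrank_range_add_finrank_ker (A.mkQ ∘ₗ P.subtype)
  have h2 := Submodule.finrank_sup_add_finrank_inf_eq P A
  rw [LinearMap.range_comp, Submodule.range_subtype, LinearMap.ker_comp, Submodule.ker_mkQ,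
    ← Submodule.finrank_map_subtype_eq, Submodule.map_comap_subtype] at h1
  omega

/-- Rank-nullity for the composite D → V → V / A; it exchanges kernel and rank conditions. -/
theorem finrank_inf_comap_add (f : Module.End ℂ V) (D A : Submodule ℂ V) :
    finrank ℂ (D ⊓ A.comap f : Submodule ℂ V) + finrank ℂ (D.map f ⊔ A : Submodule ℂ V) =
      finrank ℂ D + finrank ℂ A := by
  have h1 := LinearMap.finrank_range_add_finrank_ker (A.mkQ ∘ₗ f ∘ₗ D.subtype)
  have h2 := finrank_map_mkQ_add (D.map f) A
  rw [LinearMap.range_comp, LinearMap.range_comp, Submodule.range_subtype, LinearMap.ker_comp,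
    Submodule.ker_mkQ, Submodule.comap_comp, ← Submodule.finrank_map_subtype_eq,
    Submodule.map_comap_subtype] at h1
  omega

/-- (B ∩ P') / (B ∩ P) embeds in (B' ∩ P') / (B' ∩ P). With `P`, `P'` consecutive preimages of `A`,
this compares column lengths. -/
theorem finrank_inf_add_finrank_inf_le {B B' P P' : Submodule ℂ V} (hB : B ≤ B') (hP : P ≤ P') :
    finrank ℂ (B ⊓ P' : Submodule ℂ V) + finrank ℂ (B' ⊓ P : Submodule ℂ V) ≤
      finrank ℂ (B ⊓ P : Submodule ℂ V) + finrank ℂ (B' ⊓ P' : Submodule ℂ V) := by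
  rw [← Submodule.finrank_sup_add_finrank_inf_eq (B ⊓ P') (B' ⊓ P), add_comm]
  refine add_le_add (Submodule.finrank_mono ?_) (Submodule.finrank_mono ?_)
  · exact le_inf (inf_le_left.trans inf_le_left) (inf_le_right.trans inf_le_right)
  · exact sup_le (inf_le_inf_right _ hB) (inf_le_inf_left _ hP)

theorem finrank_sup_add_finrank_sup_le {A A' P P' : Submodule ℂ V} (hA : A' ≤ A) (hP : P' ≤ P) :
    finrank ℂ (P ⊔ A : Submodule ℂ V) + finrank ℂ (P' ⊔ A' : Submodule ℂ V) ≤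
      finrank ℂ (P' ⊔ A : Submodule ℂ V) + finrank ℂ (P ⊔ A' : Submodule ℂ V) := by
  rw [← Submodule.finrank_sup_add_finrank_inf_eq (P' ⊔ A) (P ⊔ A')]
  refine add_le_add (Submodule.finrank_mono ?_) (Submodule.finrank_mono ?_)
  · exact sup_le (le_sup_left.trans le_sup_right) (le_sup_right.trans le_sup_left)
  · exact le_inf (sup_le_sup_left hA _) (sup_le_sup_right hP _)

theorem finrank_sup_span_singleton_of_notMem {P : Submodule ℂ V} {x : V} (hx : x ∉ P) :
    finrank ℂ (P ⊔ ℂ ∙ x : Submodule ℂ V) = finrank ℂ P + 1 := by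
  have hx0 : x ≠ 0 := fun h => hx (h ▸ P.zero_mem)
  have h := Submodule.finrank_sup_add_finrank_inf_eq P (ℂ ∙ x)
  rw [(Submodule.disjoint_span_singleton' hx0).2 hx |>.eq_bot, finrank_bot,
    finrank_span_singleton hx0] at h
  exact h

theorem finrank_inf_ker_add_one {P : Submodule ℂ V} {f : Dual ℂ V} {y : V} (hy : y ∈ P)
    (hf : f y ≠ 0) :
    finrank ℂ (P ⊓ LinearMap.ker f : Submodule ℂ V) + 1 = finrank ℂ P := by
  have hy' : y ∉ P ⊓ LinearMap.ker f := fun h => hf (LinearMap.mem_ker.1 h.2)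
  rw [← finrank_sup_span_singleton_of_notMem hy']
  suffices hP : P ⊓ LinearMap.ker f ⊔ ℂ ∙ y = P by rw [hP]
  apply le_antisymm
  · exact sup_le inf_le_left ((Submodule.span_singleton_le_iff_mem _ _).2 hy)
  · intro z hz
    have hw : z - (f z / f y) • y ∈ P ⊓ LinearMap.ker f := by
      refine ⟨P.sub_mem hz (P.smul_mem _ hy), ?_⟩
      rw [SetLike.mem_coe, LinearMap.mem_ker, map_sub, map_smul, smul_eq_mul, div_mul_cancel₀ _ hf, sub_self]
    have := Submodule.add_mem_sup hw
      (Submodule.smul_mem (ℂ ∙ y) (f z / f y) (Submodule.mem_span_singleton_self y))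
    rwa [sub_add_cancel] at this

end Lattice

/-! ### The diagram of a subquotient -/

section Subquotient

variable {V : Type*} [AddCommGroup V] [Module ℂ V]

/-- The dimensions of the kernels of the powers of the endomorphism induced by `u` on `B / A` are
those given by the columns of `μ`. -/
def HasDiagram (u : Module.End ℂ V) (A B : Submodule ℂ V) (μ : YoungDiagram) : Prop :=
  ∀ q, colSum μ q + finrank ℂ A = finrank ℂ (B ⊓ A.comap (u ^ q) : Submodule ℂ V)

variable {u : Module.End ℂ V}

theorem map_pow_le {B : Submodule ℂ V} (hB : B ≤ B.comap u) (q : ℕ) : B.map (u ^ q) ≤ B := by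
  induction q with
  | zero => rw [pow_zero, Module.End.one_eq_id, Submodule.map_id]
  | succ q ih =>
    rw [pow_succ, Module.End.mul_eq_comp, Submodule.map_comp]
    exact (Submodule.map_mono (Submodule.map_le_iff_le_comap.2 hB)).trans ih

theorem map_pow_antitone {B : Submodule ℂ V} (hB : B ≤ B.comap u) :
    Antitone fun q => B.map (u ^ q) := by
  refine antitone_nat_of_succ_le fun q => ?_
  rw [pow_succ, Module.End.mul_eq_comp, Submodule.map_comp]
  exact Submodule.map_mono (Submodule.map_le_iff_le_comap.2 hB)

theorem comap_pow_monotone {A : Submodule ℂ V} (hA : A ≤ A.comap u) :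
    Monotone fun q => A.comap (u ^ q) := by
  refine monotone_nat_of_le_succ fun q => ?_
  rw [pow_succ', Module.End.mul_eq_comp, Submodule.comap_comp]
  exact Submodule.comap_mono hA

variable {A A' B B' : Submodule ℂ V} {μ ν : YoungDiagram}

theorem HasDiagram.unique (hμ : HasDiagram u A B μ) (hν : HasDiagram u A B ν) : μ = ν :=
  eq_of_colSum_eq fun q => by
    have h1 := hμ q
    have h2 := hν q
    omega

theorem isNilpotent_subquotientMap (hu : IsNilpotent u) (hA : ∀ x ∈ A, u x ∈ A)
    (hB : ∀ x ∈ B, u x ∈ B) : IsNilpotent (subquotientMap u A B hA hB) := by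
  obtain ⟨k, hk⟩ := hu
  refine ⟨k, LinearMap.ext fun x => ?_⟩
  obtain ⟨x, rfl⟩ := Submodule.mkQ_surjective _ x
  have h : (u.restrict hB ^ k) x = 0 := by
    apply Subtype.ext
    have := map_pow_apply (u := u.restrict hB) (u' := u) B.subtype (fun _ => rfl) k x
    rw [hk] at this
    exact this
  rw [← map_pow_apply (u := u.restrict hB) (A.submoduleOf B).mkQ (fun _ => rfl) k x, h, map_zero,
    LinearMap.zero_apply]

variable [FiniteDimensional ℂ V]

/-- The rank form is the one suited to minors, and to enlarging `A` by a vector. -/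
theorem hasDiagram_iff_sup : HasDiagram u A B μ ↔
    ∀ q, colSum μ q + finrank ℂ (B.map (u ^ q) ⊔ A : Submodule ℂ V) = finrank ℂ B := by
  refine forall_congr' fun q => ?_
  have := finrank_inf_comap_add (u ^ q) B A
  omega

theorem finrank_ker_subquotientMap_pow (hA : ∀ x ∈ A, u x ∈ A) (hB : ∀ x ∈ B, u x ∈ B)
    (hAB : A ≤ B) (q : ℕ) :
    finrank ℂ (LinearMap.ker (subquotientMap u A B hA hB ^ q)) + finrank ℂ A =
      finrank ℂ (B ⊓ A.comap (u ^ q) : Submodule ℂ V) := by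
  have hker : (LinearMap.ker (subquotientMap u A B hA hB ^ q)).comap (A.submoduleOf B).mkQ =
      (A.comap (u ^ q)).comap B.subtype := by
    ext x
    rw [Submodule.mem_comap, LinearMap.mem_ker,
      ← map_pow_apply (u := u.restrict hB) (A.submoduleOf B).mkQ (fun _ => rfl) q x,
      Submodule.mkQ_apply, Submodule.Quotient.mk_eq_zero, Submodule.submoduleOf,
      Submodule.mem_comap, map_pow_apply (u' := u) (u := u.restrict hB) B.subtype (fun _ => rfl) q x]
    rfl
  have h1 := finrank_map_mkQ_add
    ((LinearMap.ker (subquotientMap u A B hA hB ^ q)).comap (A.submoduleOf B).mkQ)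
    (A.submoduleOf B)
  rw [Submodule.map_comap_eq_of_surjective (Submodule.mkQ_surjective _), sup_of_le_left,
    (Submodule.submoduleOfEquivOfLe hAB).finrank_eq, hker, ← Submodule.finrank_map_subtype_eq,
    Submodule.map_comap_subtype] at h1
  · exact h1
  · exact Submodule.le_comap_mkQ _ _

/-- Column sums determine a diagram, so dimensions of subspaces of `V` replace Jordan bases of
quotients. -/
theorem jordanDiagram_subquotientMap_eq_iff (hu : IsNilpotent u) (hA : ∀ x ∈ A, u x ∈ A)
    (hB : ∀ x ∈ B, u x ∈ B) (hAB : A ≤ B) :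
    jordanDiagram (subquotientMap u A B hA hB) = μ ↔ HasDiagram u A B μ := by
  have hn := isNilpotent_subquotientMap hu hA hB
  constructor
  · rintro rfl q
    rw [colSum_jordanDiagram hn, finrank_ker_subquotientMap_pow hA hB hAB]
  · intro h
    refine eq_of_colSum_eq fun q => ?_
    have h1 := h q
    have h2 := finrank_ker_subquotientMap_pow hA hB hAB q
    rw [colSum_jordanDiagram hn]
    omega

theorem card_jordanDiagram_subquotientMap (hu : IsNilpotent u) (hA : ∀ x ∈ A, u x ∈ A)
    (hB : ∀ x ∈ B, u x ∈ B) (hAB : A ≤ B) :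
    (jordanDiagram (subquotientMap u A B hA hB)).card + finrank ℂ A = finrank ℂ B := by
  rw [card_jordanDiagram (isNilpotent_subquotientMap hu hA hB),
    ← Submodule.finrank_quotient_add_finrank (A.submoduleOf B),
    (Submodule.submoduleOfEquivOfLe hAB).finrank_eq]

theorem hasDiagram_bot_top (hu : IsNilpotent u) : HasDiagram u ⊥ ⊤ μ ↔ jordanDiagram u = μ := by
  have h : ∀ q, finrank ℂ (⊤ ⊓ (⊥ : Submodule ℂ V).comap (u ^ q) : Submodule ℂ V) =
      colSum (jordanDiagram u) q := fun q => by
    rw [top_inf_eq, Submodule.comap_bot, colSum_jordanDiagram hu]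
  simp only [HasDiagram, h, finrank_bot, add_zero]
  exact ⟨fun h => eq_of_colSum_eq fun q => (h q).symm, fun h q => by rw [h]⟩

theorem HasDiagram.le_of_le_right (hA : A ≤ A.comap u) (hBB : B ≤ B')
    (hν : HasDiagram u A B ν) (hμ : HasDiagram u A B' μ) : ν ≤ μ := by
  refine le_of_colLen_le fun q => ?_
  have h := finrank_inf_add_finrank_inf_le hBB (comap_pow_monotone hA (Nat.le_succ q))
  have h1 := hν q
  have h2 := hν (q + 1)
  have h3 := hμ q
  have h4 := hμ (q + 1)
  rw [colSum_succ] at h2 h4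
  simp only [Nat.succ_eq_add_one] at h
  omega

/-- Column `q` has length dim (u^q B + A) - dim (u^(q+1) B + A), which can only grow as `A` shrinks.
-/
theorem HasDiagram.le_of_le_left (hB : B ≤ B.comap u) (hAA : A' ≤ A)
    (hν : HasDiagram u A B ν) (hμ : HasDiagram u A' B μ) : ν ≤ μ := by
  rw [hasDiagram_iff_sup] at hν hμ
  refine le_of_colLen_le fun q => ?_
  have h := finrank_sup_add_finrank_sup_le hAA (map_pow_antitone hB (Nat.le_succ q))
  have h1 := hν q
  have h2 := hν (q + 1)
  have h3 := hμ q
  have h4 := hμ (q + 1)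
  rw [colSum_succ] at h2 h4
  simp only [Nat.succ_eq_add_one] at h
  omega

/-- A vector of `B / A` killed by `u`, in the image of `u ^ c` but not in that of `u ^ (c + 1)`. -/
theorem HasDiagram.exists_mem_notMem (hA : A ≤ A.comap u)
    (hμ : HasDiagram u A B μ) {c : ℕ} (hc : μ.colLen (c + 1) < μ.colLen c) :
    ∃ x, x ∈ B.map (u ^ c) ⊔ A ∧ u x ∈ A ∧ x ∉ B.map (u ^ (c + 1)) ⊔ A := by
  rw [hasDiagram_iff_sup] at hμ
  -- Modulo `A`, the vectors of u^q B killed by `u` form a space of dimension `μ.colLen q`, which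
  -- drops strictly from `c` to `c + 1`.
  have key : ∀ q, finrank ℂ ((B.map (u ^ q) ⊔ A) ⊓ A.comap u : Submodule ℂ V) =
      μ.colLen q + finrank ℂ A := by
    intro q
    have h1 := finrank_inf_comap_add u (B.map (u ^ q) ⊔ A) A
    have h2 : (B.map (u ^ q) ⊔ A).map u ⊔ A = B.map (u ^ (q + 1)) ⊔ A := by
      rw [Submodule.map_sup, sup_assoc, sup_of_le_right (Submodule.map_le_iff_le_comap.2 hA),
        ← Submodule.map_comp, pow_succ', Module.End.mul_eq_comp]
    rw [h2] at h1
    have h3 := hμ q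
    have h4 := hμ (q + 1)
    rw [colSum_succ] at h4
    omega
  by_contra! h
  have hle : (B.map (u ^ c) ⊔ A) ⊓ A.comap u ≤ (B.map (u ^ (c + 1)) ⊔ A) ⊓ A.comap u :=
    fun x hx => ⟨h x hx.1 hx.2, hx.2⟩
  have := Submodule.finrank_mono hle
  rw [key, key] at this
  omega

/-- Removing one box from the diagram of `B / A` by enlarging `A`. -/
theorem HasDiagram.exists_left (hA : A ≤ A.comap u) (hB : B ≤ B.comap u) (hAB : A ≤ B)
    (hμ : HasDiagram u A B μ) (hνμ : ν ≤ μ) (hcard : μ.card = ν.card + 1) :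
    ∃ A', A ≤ A' ∧ A' ≤ B ∧ A' ≤ A'.comap u ∧ finrank ℂ A' = finrank ℂ A + 1 ∧
      HasDiagram u A' B ν := by
  obtain ⟨c, hc, hcol⟩ := exists_column_of_card_succ hνμ hcard
  obtain ⟨x, hx, hux, hx'⟩ := hμ.exists_mem_notMem hA hcol
  rw [hasDiagram_iff_sup] at hμ
  refine ⟨A ⊔ ℂ ∙ x, le_sup_left, sup_le hAB ?_, sup_le ?_ ?_, ?_, ?_⟩
  · exact (Submodule.span_singleton_le_iff_mem _ _).2 ((sup_le (map_pow_le hB c) hAB) hx)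
  · exact hA.trans (Submodule.comap_mono le_sup_left)
  · exact (Submodule.span_singleton_le_iff_mem _ _).2 (Submodule.mem_sup_left hux)
  · exact finrank_sup_span_singleton_of_notMem fun h => hx' (Submodule.mem_sup_right h)
  · rw [hasDiagram_iff_sup]
    intro q
    have h1 := hμ q
    rw [hc q] at h1
    rw [← sup_assoc]
    -- `x` already lies in u^q B + A for q ≤ c and in none of these spaces for q > c, so exactly
    -- column `c` loses a box.
    split_ifs at h1 with hq
    · rw [finrank_sup_span_singleton_of_notMem]
      · omega
      · exact fun h => hx' (sup_le_sup_right (map_pow_antitone hB hq) A h)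
    · rw [sup_of_le_left]
      · exact h1
      · rw [Submodule.span_singleton_le_iff_mem]
        exact sup_le_sup_right (map_pow_antitone hB (not_lt.1 hq)) A hx

/-- Removing one box from the diagram of `B / A` by shrinking `B`. -/
theorem HasDiagram.exists_right (hA : A ≤ A.comap u) (hB : B ≤ B.comap u) (hAB : A ≤ B)
    (hμ : HasDiagram u A B μ) (hνμ : ν ≤ μ) (hcard : μ.card = ν.card + 1) :
    ∃ B', A ≤ B' ∧ B' ≤ B ∧ B' ≤ B'.comap u ∧ finrank ℂ B' + 1 = finrank ℂ B ∧
      HasDiagram u A B' ν := by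
  obtain ⟨c, hc, hcol⟩ := exists_column_of_card_succ hνμ hcard
  obtain ⟨x, hx, hux, hx'⟩ := hμ.exists_mem_notMem hA hcol
  obtain ⟨_, ⟨y, hy, rfl⟩, a, ha, rfl⟩ := Submodule.mem_sup.1 hx
  -- `y` is the top of a Jordan chain of length `c + 1`: if it lay in this sum, applying u^c would
  -- put `x` in u^(c+1) B + A.
  have hy' : y ∉ B.map u ⊔ A ⊔ B ⊓ A.comap (u ^ c) := by
    intro h
    obtain ⟨_, h', k, ⟨-, hk⟩, rfl⟩ := Submodule.mem_sup.1 h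
    obtain ⟨_, ⟨b, hb, rfl⟩, a', ha', rfl⟩ := Submodule.mem_sup.1 h'
    apply hx'
    rw [map_add, map_add, ← Module.End.mul_apply, ← pow_succ, add_assoc, add_assoc]
    refine Submodule.add_mem_sup ⟨b, hb, rfl⟩ (A.add_mem ?_ (A.add_mem hk ha))
    exact map_pow_le hA c ⟨a', ha', rfl⟩
  obtain ⟨f, hfy, hf⟩ := Submodule.exists_le_ker_of_notMem hy'
  have hfB : B.map u ≤ LinearMap.ker f := (le_sup_left.trans le_sup_left).trans hf
  have hfA : A ≤ LinearMap.ker f := (le_sup_right.trans le_sup_left).trans hf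
  have hfK : B ⊓ A.comap (u ^ c) ≤ LinearMap.ker f := le_sup_right.trans hf
  have huy : (u ^ (c + 1)) y ∈ A := by
    have := A.sub_mem hux (hA ha)
    rwa [map_add, add_sub_cancel_right, ← Module.End.mul_apply, ← pow_succ'] at this
  -- The hyperplane is stable because `f` kills u B. It contains B ∩ (u^q)⁻¹A for q ≤ c, but for q >
  -- c misses its element `y`.
  refine ⟨B ⊓ LinearMap.ker f, le_inf hAB hfA, inf_le_left,
    fun z hz => ⟨hB hz.1, hfB ⟨z, hz.1, rfl⟩⟩, finrank_inf_ker_add_one hy hfy, fun q => ?_⟩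
  have h1 := hμ q
  rw [hc q] at h1
  rw [inf_right_comm]
  split_ifs at h1 with hq
  · have := finrank_inf_ker_add_one (P := B ⊓ A.comap (u ^ q))
      ⟨hy, comap_pow_monotone hA hq huy⟩ hfy
    omega
  · rw [inf_of_le_left]
    · exact h1
    · exact (inf_le_inf_left B (comap_pow_monotone hA (not_lt.1 hq))).trans hfK

/-- Given diagrams which grow by one box at each step, there is a chain of stable subspaces whose
subquotients `V_{j_k} / V_{i_k}` have these diagrams. -/
theorem exists_chain_hasDiagram {n : ℕ} {Y : ℕ → YoungDiagram} (hY : Monotone Y)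
    (hcard : ∀ k ≤ n, (Y k).card = k) {i j : ℕ → ℕ} (hi : Antitone i) (hj : Monotone j)
    (hij : ∀ k ≤ n, i k + k = j k) :
    ∀ k ≤ n, ∀ A B : Submodule ℂ V, A ≤ B → A ≤ A.comap u → B ≤ B.comap u →
      finrank ℂ A = i k → finrank ℂ B = j k → HasDiagram u A B (Y k) →
      ∃ G : ℕ → Submodule ℂ V, G (i k) = A ∧ G (j k) = B ∧
        (∀ p, i k ≤ p → p ≤ j k → finrank ℂ (G p) = p ∧ G p ≤ (G p).comap u) ∧
        (∀ p, i k ≤ p → p < j k → G p ≤ G (p + 1)) ∧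
        ∀ l ≤ k, HasDiagram u (G (i l)) (G (j l)) (Y l) := by
  intro k
  induction k with
  | zero =>
    intro _ A B hAB hA hB hAi hBj hd
    have h0 : i 0 = j 0 := hij 0 (Nat.zero_le _)
    obtain rfl : A = B := Submodule.eq_of_le_of_finrank_le hAB (by omega)
    refine ⟨fun _ => A, rfl, rfl, fun p h1 h2 => ⟨hAi.trans (by omega), hA⟩, fun p _ _ => le_rfl, ?_⟩
    intro l hl
    obtain rfl : l = 0 := Nat.le_zero.1 hl
    exact hd
  | succ k ih =>
    intro hk A B hAB hA hB hAi hBj hd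
    have e1 := hij k (by omega)
    have e2 := hij (k + 1) hk
    have e3 := hi (Nat.le_succ k)
    have e4 := hj (Nat.le_succ k)
    have hYk : (Y (k + 1)).card = (Y k).card + 1 := by
      rw [hcard _ hk, hcard k (by omega)]
    rw [Nat.succ_eq_add_one] at e3 e4
    -- Since j - i grows by one, either `i` is fixed and `j` rises by one, or `j` is fixed and `i`
    -- falls by one. The chain is then extended at that single new index.
    rcases e3.eq_or_lt with h | h
    · have hj' : j (k + 1) = j k + 1 := by omega
      obtain ⟨B', h1, h2, h3, h4, h5⟩ := hd.exists_right hA hB hAB (hY (Nat.le_succ k)) hYk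
      obtain ⟨G, rfl, rfl, hG, hGm, hGd⟩ :=
        ih (by omega) A B' h1 hA h3 (by omega) (by omega) h5
      refine ⟨Function.update G (j (k + 1)) B, ?_, ?_, ?_, ?_, ?_⟩
      · rw [h, Function.update_of_ne (by omega)]
      · rw [Function.update_self]
      · intro p hp1 hp2
        rcases hp2.eq_or_lt with rfl | hp2
        · rw [Function.update_self]
          exact ⟨hBj, hB⟩
        · rw [Function.update_of_ne hp2.ne]
          exact hG p (by omega) (by omega)
      · intro p hp1 hp2
        rw [Function.update_of_ne hp2.ne]
        rcases (show p + 1 = j (k + 1) ∨ p + 1 < j (k + 1) by omega) with hp | hp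
        · rw [hp, Function.update_self]
          obtain rfl : p = j k := by omega
          exact h2
        · rw [Function.update_of_ne (by omega)]
          exact hGm p (by omega) (by omega)
      · intro l hl
        rcases hl.eq_or_lt with rfl | hl
        · rw [Function.update_self, Function.update_of_ne (by omega), h]
          exact hd
        · have := hj (Nat.lt_succ_iff.1 hl)
          have := hij l (by omega)
          rw [Function.update_of_ne (by omega), Function.update_of_ne (by omega)]
          exact hGd l (by omega)
    · have hi' : i k = i (k + 1) + 1 := by omega
      have hj' : j (k + 1) = j k := by omega
      obtain ⟨A', h1, h2, h3, h4, h5⟩ := hd.exists_left hA hB hAB (hY (Nat.le_succ k)) hYk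
      obtain ⟨G, rfl, rfl, hG, hGm, hGd⟩ :=
        ih (by omega) A' B h2 h3 hB (by omega) (by omega) h5
      refine ⟨Function.update G (i (k + 1)) A, ?_, ?_, ?_, ?_, ?_⟩
      · rw [Function.update_self]
      · rw [hj', Function.update_of_ne (by omega)]
      · intro p hp1 hp2
        rcases hp1.eq_or_lt with rfl | hp1
        · rw [Function.update_self]
          exact ⟨hAi, hA⟩
        · rw [Function.update_of_ne hp1.ne']
          exact hG p (by omega) (by omega)
      · intro p hp1 hp2
        rw [Function.update_of_ne (a := p + 1) (by omega)]
        rcases hp1.eq_or_lt with rfl | hp1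
        · rw [Function.update_self, ← hi']
          exact h1
        · rw [Function.update_of_ne hp1.ne']
          exact hGm p (by omega) (by omega)
      · intro l hl
        rcases hl.eq_or_lt with rfl | hl
        · rw [Function.update_self, Function.update_of_ne (by omega), hj']
          exact hd
        · have := hi (Nat.lt_succ_iff.1 hl)
          have := hij l (by omega)
          rw [Function.update_of_ne (by omega), Function.update_of_ne (by omega)]
          exact hGd l (by omega)

end Subquotient

open scoped Topology

/-! ### Rank conditions are closed in the Zariski topology -/

theorem isClosed_zariskiTopology_zeroSet {W : Type*} [AddCommGroup W] [Module ℂ W] {p : W → ℂ}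
    (hp : p ∈ polynomialFunctions W) : IsClosed[zariskiTopology W] {x | p x = 0} := by
  let _ := zariskiTopology W
  rw [← isOpen_compl_iff]
  exact TopologicalSpace.isOpen_generateFrom_of_mem ⟨p, hp, rfl⟩

/-- Each entry is a linear form in `x`, so the Leibniz expansion is a polynomial. -/
theorem det_mem_polynomialFunctions {W V : Type*} [AddCommGroup W] [Module ℂ W] [AddCommGroup V]
    [Module ℂ V] {m : ℕ} (f : Fin m → Dual ℂ V) (g : Fin m → W →ₗ[ℂ] V) :
    (fun x => (Matrix.of fun s t => f s (g t x)).det) ∈ polynomialFunctions W := by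
  have h : (fun x => (Matrix.of fun s t => f s (g t x)).det) =
      ∑ σ : Equiv.Perm (Fin m), Equiv.Perm.sign σ • ∏ t, ((f (σ t) ∘ₗ g t : Dual ℂ W) : W → ℂ) := by
    funext x
    rw [Matrix.det_apply, Finset.sum_apply]
    refine Finset.sum_congr rfl fun σ _ => ?_
    rw [Pi.smul_apply, Finset.prod_apply]
    rfl
  rw [h]
  refine Subalgebra.sum_mem _ fun σ _ => ?_
  have hprod : ∏ t, ((f (σ t) ∘ₗ g t : Dual ℂ W) : W → ℂ) ∈ polynomialFunctions W :=
    Subalgebra.prod_mem _ fun t _ => Algebra.subset_adjoin ⟨_, rfl⟩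
  rcases Int.units_eq_one_or (Equiv.Perm.sign σ) with hσ | hσ <;> rw [hσ]
  · rwa [one_smul]
  · rw [Units.neg_smul, one_smul]
    exact Subalgebra.neg_mem _ hprod

section Rank

variable {V : Type*} [AddCommGroup V] [Module ℂ V]

theorem exists_dual_eq_ite {m : ℕ} {w : Fin m → V} (hw : LinearIndependent ℂ w) :
    ∃ f : Fin m → Dual ℂ V, ∀ s t, f s (w t) = if s = t then 1 else 0 := by
  obtain ⟨g, hg⟩ := LinearMap.exists_leftInverse_of_injective _ (linearIndependent_iff_ker.1 hw)
  refine ⟨fun s => Finsupp.lapply s ∘ₗ g, fun s t => ?_⟩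
  have h := LinearMap.congr_fun hg (Finsupp.single t 1)
  rw [LinearMap.comp_apply, Finsupp.linearCombination_single, one_smul] at h
  rw [LinearMap.comp_apply, h, LinearMap.id_apply, Finsupp.lapply_apply, Finsupp.single_apply]
  simp only [eq_comm]

/-- Coordinate-free vanishing of the minors of size `r + 1`. If the rank exceeds `r`, dual
functionals to `r + 1` independent vectors give the identity matrix. -/
theorem finrank_span_range_le_iff [FiniteDimensional ℂ V] {ι : Type*} [Finite ι] (w : ι → V)
    (r : ℕ) :
    finrank ℂ (Submodule.span ℂ (Set.range w)) ≤ r ↔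
      ∀ (a : Fin (r + 1) → ι) (f : Fin (r + 1) → Dual ℂ V),
        (Matrix.of fun s t => f s (w (a t))).det = 0 := by
  constructor
  · intro h a f
    by_contra hdet
    have hcol := Matrix.linearIndependent_cols_of_det_ne_zero hdet
    have hli : LinearIndependent ℂ (w ∘ a) :=
      LinearIndependent.of_comp (LinearMap.pi f) hcol
    have h1 := finrank_span_eq_card hli
    have h2 : finrank ℂ (Submodule.span ℂ (Set.range (w ∘ a))) ≤
        finrank ℂ (Submodule.span ℂ (Set.range w)) :=
      Submodule.finrank_mono (Submodule.span_mono (Set.range_comp_subset_range a w))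
    rw [Fintype.card_fin] at h1
    omega
  · intro h
    by_contra! hlt
    obtain ⟨κ, a, ha, hspan, hli⟩ := exists_linearIndependent' ℂ w
    have : Finite κ := Finite.of_injective a ha
    have := Fintype.ofFinite κ
    rw [← hspan, finrank_span_eq_card hli] at hlt
    obtain ⟨e⟩ : Nonempty (Fin (r + 1) ↪ κ) :=
      Function.Embedding.nonempty_of_card_le (by rw [Fintype.card_fin]; exact hlt)
    obtain ⟨f, hf⟩ := exists_dual_eq_ite (hli.comp e e.injective)
    have hdet := h (a ∘ e) f
    have hone : (Matrix.of fun s t => f s (w ((a ∘ e) t))) = (1 : Matrix _ _ ℂ) := by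
      ext s t
      rw [Matrix.of_apply, Matrix.one_apply]
      exact hf s t
    rw [hone, Matrix.det_one] at hdet
    exact one_ne_zero hdet

variable [FiniteDimensional ℂ V]

/-- In the quotient topology it suffices to look at bases, where g V_j + V_i is spanned by vectors
depending linearly on the basis; the condition becomes vanishing of minors. -/
theorem isClosed_finrank_map_sup_le (g : Module.End ℂ V) (i j : Fin (finrank ℂ V + 1)) (r : ℕ) :
    IsClosed {F : CompleteFlag V |
      finrank ℂ ((F.space j).map g ⊔ F.space i : Submodule ℂ V) ≤ r} := by
  let _ := basisTopology V
  rw [isClosed_coinduced]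
  let ι := {m : Fin (finrank ℂ V) // m.castSucc < j} ⊕ {m : Fin (finrank ℂ V) // m.castSucc < i}
  let ℓ : ι → (Fin (finrank ℂ V) → V) →ₗ[ℂ] V :=
    Sum.elim (fun m => g ∘ₗ LinearMap.proj m.1) fun m => LinearMap.proj m.1
  have hspan : ∀ b : Basis (Fin (finrank ℂ V)) ℂ V,
      (b.flag j).map g ⊔ b.flag i = Submodule.span ℂ (Set.range fun s : ι => ℓ s fun m => b m) := by
    intro b
    rw [Basis.flag, Basis.flag, Submodule.map_span, ← Submodule.span_union]
    congr 1
    ext x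
    simp only [Set.mem_union, Set.mem_image, Set.mem_ofPred_eq, Set.mem_range, Sum.exists,
      Subtype.exists, ι, ℓ, Sum.elim_inl, Sum.elim_inr, LinearMap.comp_apply, LinearMap.proj_apply,
      exists_exists_and_eq_and, exists_prop]
  have hset : CompleteFlag.ofBasis ⁻¹' {F : CompleteFlag V |
      finrank ℂ ((F.space j).map g ⊔ F.space i : Submodule ℂ V) ≤ r} =
      ⋂ (a : Fin (r + 1) → ι) (f : Fin (r + 1) → Dual ℂ V),
        (fun (b : Basis (Fin (finrank ℂ V)) ℂ V) m => b m) ⁻¹'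
          {x | (Matrix.of fun s t => f s (ℓ (a t) x)).det = 0} := by
    ext b
    simp only [Set.mem_iInter, Set.mem_preimage, Set.mem_ofPred_eq]
    rw [← finrank_span_range_le_iff (fun s : ι => ℓ s fun m => b m) r, ← hspan b]
    rfl
  rw [hset]
  refine isClosed_iInter fun a => isClosed_iInter fun f => ?_
  exact (@isClosed_induced_iff _ _ (zariskiTopology _) _ _).2 ⟨_, isClosed_zariskiTopology_zeroSet
    (det_mem_polynomialFunctions f fun t => ℓ (a t)), rfl⟩

theorem isClosed_finrank_map_sup_add_le (u g : Module.End ℂ V) (i j : Fin (finrank ℂ V + 1))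
    (c d : ℕ) :
    IsClosed {F : Fiber u |
      finrank ℂ ((F.1.space j).map g ⊔ F.1.space i : Submodule ℂ V) + c ≤ d} := by
  by_cases h : c ≤ d
  · convert (isClosed_finrank_map_sup_le g i j (d - c)).preimage continuous_subtype_val using 1
    ext F
    simp only [Set.mem_ofPred_eq, Set.mem_preimage]
    omega
  · convert isClosed_empty using 1
    ext F
    simp only [Set.mem_ofPred_eq, Set.mem_empty_iff_false, iff_false]
    omega

end Rank

/-! ### The pieces of the Springer fiber -/

theorem exists_equiv_fin_antitone {α : Type*} [Finite α] (f : α → ℕ) :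
    ∃ (k : ℕ) (e : Fin k ≃ α), Antitone (f ∘ e) := by
  obtain ⟨k, ⟨e⟩⟩ := Finite.exists_equiv_fin α
  let g : Fin k → ℕᵒᵈ := fun i => OrderDual.toDual (f (e.symm i))
  exact ⟨k, (Tuple.sort g).trans e.symm, fun _ _ h => Tuple.monotone_sort g h⟩

section Pieces

variable {V : Type*} [AddCommGroup V] [Module ℂ V] {u : Module.End ℂ V}
  {ρ : DoubleSequence (finrank ℂ V)}

theorem DoubleSequence.i_le_j {n : ℕ} (ρ : DoubleSequence n) (k : Fin (n + 1)) : ρ.i k ≤ ρ.j k := by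
  rw [Fin.le_def, ← ρ.add_eq k]
  exact Nat.le_add_right _ _

theorem DoubleSequence.i_last {n : ℕ} (ρ : DoubleSequence n) : ρ.i (Fin.last n) = 0 := by
  have h1 := ρ.add_eq (Fin.last n)
  have h2 := (ρ.j (Fin.last n)).2
  rw [Fin.val_last] at h1
  ext
  rw [Fin.val_zero]
  omega

theorem DoubleSequence.j_last {n : ℕ} (ρ : DoubleSequence n) : ρ.j (Fin.last n) = Fin.last n := by
  have h1 := ρ.add_eq (Fin.last n)
  rw [ρ.i_last, Fin.val_zero] at h1
  ext
  omega

variable [FiniteDimensional ℂ V]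

theorem CompleteFlag.space_zero (F : CompleteFlag V) : F.space 0 = ⊥ := by
  have h := F.finrank_space 0
  rw [Fin.val_zero] at h
  exact Submodule.finrank_eq_zero.1 h

theorem CompleteFlag.space_last (F : CompleteFlag V) : F.space (Fin.last _) = ⊤ := by
  have h := F.finrank_space (Fin.last _)
  rw [Fin.val_last] at h
  exact Submodule.eq_top_of_finrank_eq h

theorem mem_piece_iff (hu : IsNilpotent u) {μ : YoungDiagram} {T : StandardTableau μ}
    {F : Fiber u} : F ∈ piece u ρ T ↔
      ∀ k : Fin (finrank ℂ V + 1),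
        HasDiagram u (F.1.space (ρ.i k)) (F.1.space (ρ.j k)) (T.shape k) :=
  forall_congr' fun k => jordanDiagram_subquotientMap_eq_iff hu _ _ (F.1.mono (ρ.i_le_j k))

theorem exists_hasDiagram (hu : IsNilpotent u) {A B : Submodule ℂ V} (hA : A ≤ A.comap u)
    (hB : B ≤ B.comap u) (hAB : A ≤ B) :
    ∃ μ, HasDiagram u A B μ ∧ μ.card + finrank ℂ A = finrank ℂ B :=
  ⟨_, (jordanDiagram_subquotientMap_eq_iff hu hA hB hAB).1 rfl,
    card_jordanDiagram_subquotientMap hu hA hB hAB⟩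

theorem exists_mem_piece (hu : IsNilpotent u) (F : Fiber u) :
    ∃ T : StandardTableau (jordanDiagram u), F ∈ piece u ρ T := by
  have hcard := card_jordanDiagram hu
  have hex := fun k => exists_hasDiagram hu (F.2 (ρ.i k)) (F.2 (ρ.j k)) (F.1.mono (ρ.i_le_j k))
  choose Y hY hYcard using hex
  have hmono : Monotone Y := by
    intro k l hkl
    -- V_{j_k} / V_{i_l} is an intermediate step: first shrink the lower space, then enlarge the
    -- upper one.
    obtain ⟨ν, hν, -⟩ := exists_hasDiagram hu (F.2 (ρ.i l)) (F.2 (ρ.j k))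
      (F.1.mono ((ρ.anti hkl).trans (ρ.i_le_j k)))
    exact ((hY k).le_of_le_left (F.2 _) (F.1.mono (ρ.anti hkl)) hν).trans
      (hν.le_of_le_right (F.2 _) (F.1.mono (ρ.mono hkl)) (hY l))
  have hYk : ∀ k, (Y k).card = k := by
    intro k
    have h := hYcard k
    rw [F.1.finrank_space, F.1.finrank_space, ← ρ.add_eq k] at h
    omega
  have hlast : Y (Fin.last _) = jordanDiagram u := by
    have h := hY (Fin.last _)
    rw [ρ.i_last, ρ.j_last, F.1.space_zero, F.1.space_last] at h
    exact ((hasDiagram_bot_top hu).1 h).symm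
  -- Clamping at the dimension extends the finite chain to all of ℕ.
  let c : ℕ → Fin (finrank ℂ V + 1) := fun k =>
    ⟨min k (finrank ℂ V), Nat.lt_succ_of_le (min_le_right _ _)⟩
  have hc : ∀ k : Fin (finrank ℂ V + 1), c k = k := fun k =>
    Fin.ext (min_eq_left (Nat.lt_succ_iff.1 k.2))
  obtain ⟨T, hT⟩ := StandardTableau.exists_of_chain (μ := jordanDiagram u) (fun k => Y (c k))
    (fun k l hkl => hmono (min_le_min_right _ hkl))
    (fun k hk => by
      rw [hYk]
      exact min_eq_left (hk.trans hcard.le))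
    (by
      rw [← hlast]
      congr 1
      ext
      rw [hlast, hcard]
      exact min_self _)
  refine ⟨T, (mem_piece_iff hu).2 fun k => ?_⟩
  rw [hT k (by rw [hcard]; exact Nat.lt_succ_iff.1 k.2), hc]
  exact hY k

theorem piece_nonempty (hu : IsNilpotent u) (T : StandardTableau (jordanDiagram u)) :
    (piece u ρ T).Nonempty := by
  have hcard := card_jordanDiagram hu
  let c : ℕ → Fin (finrank ℂ V + 1) := fun k =>
    ⟨min k (finrank ℂ V), Nat.lt_succ_of_le (min_le_right _ _)⟩
  have hc : ∀ k : Fin (finrank ℂ V + 1), c k = k := fun k =>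
    Fin.ext (min_eq_left (Nat.lt_succ_iff.1 k.2))
  have hcmono : Monotone c := fun k l hkl => min_le_min_right _ hkl
  have hlast : c (finrank ℂ V) = Fin.last _ := hc (Fin.last _)
  obtain ⟨G, -, -, hG, hGm, hGd⟩ := exists_chain_hasDiagram (u := u) (Y := T.shape)
    (n := finrank ℂ V) (fun _ _ => T.shape_mono) (fun k hk => T.card_shape (hk.trans hcard.ge))
    (i := fun k => ρ.i (c k)) (j := fun k => ρ.j (c k)) (fun _ _ h => ρ.anti (hcmono h))
    (fun _ _ h => ρ.mono (hcmono h))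
    (fun k hk => by
      rw [← ρ.add_eq]
      exact congrArg _ (min_eq_left hk).symm)
    (finrank ℂ V) le_rfl ⊥ ⊤ bot_le bot_le le_top
    (by rw [hlast, ρ.i_last, finrank_bot, Fin.val_zero])
    (by rw [hlast, ρ.j_last, finrank_top, Fin.val_last])
    (by
      rw [hasDiagram_bot_top hu, ← hcard, T.shape_of_card_le le_rfl])
  simp only [hlast, ρ.i_last, ρ.j_last, Fin.val_zero, Fin.val_last] at hG hGm
  refine ⟨⟨⟨fun k => G k, Fin.monotone_iff_le_succ.2 fun k => ?_, fun k => ?_⟩, fun k => ?_⟩,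
    (mem_piece_iff hu).2 fun k => ?_⟩
  · exact hGm k (Nat.zero_le _) k.2
  · exact (hG k (Nat.zero_le _) (Nat.lt_succ_iff.1 k.2)).1
  · exact (hG k (Nat.zero_le _) (Nat.lt_succ_iff.1 k.2)).2
  · have h := hGd k (Nat.lt_succ_iff.1 k.2)
    rw [hc] at h
    exact h

theorem eq_of_mem_piece (hu : IsNilpotent u) {S T : StandardTableau (jordanDiagram u)}
    {F : Fiber u} (hS : F ∈ piece u ρ S) (hT : F ∈ piece u ρ T) : S = T := by
  refine StandardTableau.eq_of_shape_eq fun k hk => ?_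
  rw [card_jordanDiagram hu] at hk
  exact ((mem_piece_iff hu).1 hS ⟨k, Nat.lt_succ_of_le hk⟩).unique
    ((mem_piece_iff hu).1 hT ⟨k, Nat.lt_succ_of_le hk⟩)

/-- Semicontinuity of rank: the upper bound on dim (u^q V_j + V_i) valid on the piece of `T`
persists on its closure, bounding the column sums of `S` from below. -/
theorem dominance_of_mem_closure (hu : IsNilpotent u) {S T : StandardTableau (jordanDiagram u)}
    {F : Fiber u} (hT : F ∈ closure (piece u ρ T)) (hS : F ∈ piece u ρ S) : S.Dominance T := by
  refine StandardTableau.dominance_of_colSum_le fun k hk q => ?_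
  rw [card_jordanDiagram hu] at hk
  let l : Fin (finrank ℂ V + 1) := ⟨k, Nat.lt_succ_of_le hk⟩
  have hsub : piece u ρ T ⊆ {F : Fiber u | finrank ℂ
      ((F.1.space (ρ.j l)).map (u ^ q) ⊔ F.1.space (ρ.i l) : Submodule ℂ V) +
        colSum (T.shape k) q ≤ ρ.j l} := by
    intro F hF
    have h := hasDiagram_iff_sup.1 ((mem_piece_iff hu).1 hF l) q
    rw [F.1.finrank_space, add_comm] at h
    exact h.le
  have h1 := closure_minimal hsub (isClosed_finrank_map_sup_add_le _ _ _ _ _ _) hT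
  have h2 := hasDiagram_iff_sup.1 ((mem_piece_iff hu).1 hS l) q
  rw [F.1.finrank_space] at h2
  rw [Set.mem_ofPred_eq] at h1
  change colSum (S.shape k) q + _ = _ at h2
  omega

theorem closure_piece_subset (hu : IsNilpotent u) (T : StandardTableau (jordanDiagram u)) :
    closure (piece u ρ T) ⊆
      ⋃ S : StandardTableau (jordanDiagram u), ⋃ _ : S.Dominance T, piece u ρ S := by
  intro F hF
  obtain ⟨S, hS⟩ := exists_mem_piece (ρ := ρ) hu F
  exact Set.mem_iUnion₂.2 ⟨S, dominance_of_mem_closure hu hF hS, hS⟩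

theorem isAlphaPartition_piece (hu : IsNilpotent u) :
    IsAlphaPartition fun T : StandardTableau (jordanDiagram u) => piece u ρ T where
  nonempty := piece_nonempty hu
  disjoint S T hST := Set.disjoint_left.2 fun _ hS hT => hST (eq_of_mem_piece hu hS hT)
  iUnion_eq := Set.eq_univ_of_forall fun F => Set.mem_iUnion.2 (exists_mem_piece hu F)
  exists_order := by
    obtain ⟨k, e, he⟩ := exists_equiv_fin_antitone
      (StandardTableau.weight : StandardTableau (jordanDiagram u) → ℕ)
    refine ⟨k, e, fun l => isClosed_of_closure_subset ?_⟩
    rw [closure_iUnion_of_finite]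
    refine Set.iUnion_subset fun m => ?_
    rw [closure_iUnion_of_finite]
    refine Set.iUnion_subset fun hm F hF => ?_
    obtain ⟨S, hdom, hS⟩ := Set.mem_iUnion₂.1 (closure_piece_subset hu _ hF)
    obtain ⟨m', rfl⟩ := e.surjective S
    refine Set.mem_iUnion₂.2 ⟨m', ?_, hS⟩
    -- A tableau below `e m` listed after `l ≥ m` would have no larger weight, hence would be `e m`
    -- itself.
    by_contra! hlt
    have := e.injective (StandardTableau.eq_of_dominance_of_weight_le hdom (he (hm.trans hlt.le)))
    exact absurd (this ▸ hlt) hm.not_gt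

end Pieces

end SpringerFiber

end

theorem mainTheorem6 {V : Type*} [AddCommGroup V] [Module ℂ V] [FiniteDimensional ℂ V]
    (u : Module.End ℂ V) (hu : IsNilpotent u)
    (ρ : SpringerFiber.DoubleSequence (Module.finrank ℂ V)) :
    (∀ T : SpringerFiber.StandardTableau (SpringerFiber.jordanDiagram u),
      closure (SpringerFiber.piece u ρ T) ⊆
        ⋃ S : SpringerFiber.StandardTableau (SpringerFiber.jordanDiagram u),
          ⋃ _ : S.Dominance T, SpringerFiber.piece u ρ S) ∧
    SpringerFiber.IsAlphaPartition
      (fun T : SpringerFiber.StandardTableau (SpringerFiber.jordanDiagram u) =>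
        SpringerFiber.piece u ρ T) :=
  ⟨SpringerFiber.closure_piece_subset hu, SpringerFiber.isAlphaPartition_piece hu⟩
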